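/- Let $d$ be a squarefree integer, and let $E^d$ be the elliptic curve $dy^2=x(x+3)(x-1)$ over $\mathbb{Q}$. There exists a non-constant arithmetic progression consisting of four squares in $\mathbb{Q}(\sqrt d)$ if and only if $\operatorname{rank} E^d(\mathbb{Q})\neq 0$. In this case there exist infinitely many such progressions, even up to scaling: the points $[s_0:s_1:s_2:s_3]\in\mathbb{P}^3(\mathbb{Q}(\sqrt d))$, where $(s_0,s_1,s_2,s_3)$ runs through the non-constant arithmetic progressions of four squares in $\mathbb{Q}(\sqrt d)$, form an infinite set. -/

import Mathlib

/-- `s 0, s 1, s 2, s 3` is a non-constant arithmetic progression of four squares in `K`. -/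
def IsNonconstFourSquareAP {K : Type*} [Field K] (s : Fin 4 → K) : Prop :=
  (∃ r : K, r ≠ 0 ∧ ∀ i : Fin 4, s i = s 0 + ((i : ℕ) : K) * r) ∧ ∀ i : Fin 4, IsSquare (s i)

/-- The points `[s 0 : s 1 : s 2 : s 3]` of projective 3-space over `K` given by the non-constant
arithmetic progressions of four squares in `K`, that is, these progressions up to multiplication by
a common factor in `Kˣ`. -/
def fourSquareAPClasses (K : Type*) [Field K] : Set (Projectivization K (Fin 4 → K)) :=
  {P | ∃ (s : Fin 4 → K) (hs : s ≠ 0), IsNonconstFourSquareAP s ∧ P = Projectivization.mk K s hs}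

/-- The quadratic twist `E^d : d * y ^ 2 = x * (x + 3) * (x - 1)` over `ℚ`, in the Weierstrass form
`Y ^ 2 = X * (X + 3 * d) * (X - d)` obtained from it by `X = d * x`, `Y = d ^ 2 * y`. -/
def twistE (d : ℤ) : WeierstrassCurve.Affine ℚ where
  a₁ := 0
  a₂ := 2 * d
  a₃ := 0
  a₄ := -3 * d ^ 2
  a₆ := 0

/-- `(x, y) ↦ (d * x, d ^ 2 * y)`, a bijection of `ℚ × ℚ`, identifies the affine points of
`d * y ^ 2 = x * (x + 3) * (x - 1)` with those of `twistE d`. -/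
theorem twistE_equation_iff (d : ℤ) (hd : d ≠ 0) (x y : ℚ) :
    (twistE d).Equation (d * x) (d ^ 2 * y) ↔ (d : ℚ) * y ^ 2 = x * (x + 3) * (x - 1) := by
  have hd' : (d : ℚ) ^ 3 ≠ 0 := pow_ne_zero 3 (Int.cast_ne_zero.mpr hd)
  rw [WeierstrassCurve.Affine.equation_iff, ← mul_right_inj' (b := (d : ℚ) * y ^ 2) hd']
  simp only [twistE]
  constructor <;> intro h <;> linear_combination h

/-- For `d ≠ 0` the twist is an elliptic curve; in particular all its points are nonsingular. -/
theorem twistE_isElliptic (d : ℤ) (hd : d ≠ 0) : WeierstrassCurve.IsElliptic (twistE d) := by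
  have hd' : (d : ℚ) ≠ 0 := Int.cast_ne_zero.mpr hd
  refine ⟨isUnit_iff_ne_zero.mpr ?_⟩
  have : WeierstrassCurve.Δ (twistE d) = 2304 * (d : ℚ) ^ 6 := by
    simp only [WeierstrassCurve.Δ, WeierstrassCurve.b₂, WeierstrassCurve.b₄, WeierstrassCurve.b₆,
      WeierstrassCurve.b₈, twistE]
    ring
  rw [this]
  positivity

/-! The relation a² + c² = 2b² between the roots of the first three squares is a conic: up to a
factor, (a, b, c) = (t² - 2t - 1, t² + 1, t² + 2t - 1). The fourth square then requires f² = t⁴ +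
8t³ + 2t² - 8t + 1, a model of E : y² = x(x + 3)(x - 1). A nonconstant progression over K = ℚ(√d)
thus gives a point P of E(K) with abscissa outside 0, -3, 1, 3, -1
(`IsNonconstFourSquareAP.exists_point`). Over ℚ no such point exists, by Fermat descent
(`rat_points_trivial`); this settles the forward implication for d = 1.

For d ≠ 1 let σ be the conjugation of K. The point R = P - σP satisfies σR = -R. If 2R = 0, then 2P
is rational, which `trivial_of_double_rational` excludes. Otherwise R = (p, q√d) with q ≠ 0, a point
of E^d(ℚ) not killed by 2. Such a point has infinite order (`twistE_not_isOfFinAddOrder`): its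
repeated doubles never reach the 2-torsion, and the 2-adic poles of their abscissae grow without
bound. Hence the rank is nonzero.

Conversely, nonzero rank makes E^d(ℚ), hence E(K), infinite. The scale-invariant ratio of first term
to common difference is a nonconstant function of t, so infinitely many classes arise
(`fourSquareAPClasses_infinite`). -/

/-! ### Fermat descent: the rational points of y² = x(x + 3)(x - 1) -/

/-- Coprime solutions of `4α² + δ² = γ²`, `α² + δ² = β²` with `δ` odd come from coprime solutions
of `p⁴ - p²q² + q⁴ = β²` with `α = pq`. -/
theorem exists_quartic_of_sq_add_sq {α β γ δ : ℤ} (hδ : δ % 2 = 1) (hcop : IsCoprime α δ)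
    (h1 : α ^ 2 + δ ^ 2 = β ^ 2) (h2 : 4 * α ^ 2 + δ ^ 2 = γ ^ 2) :
    ∃ p q : ℤ, α = p * q ∧ IsCoprime p q ∧ (p % 2 = 0 ∧ q % 2 = 1 ∨ p % 2 = 1 ∧ q % 2 = 0) ∧
      p ^ 4 - p ^ 2 * q ^ 2 + q ^ 4 = β ^ 2 := by
  have hγ : γ ≠ 0 := by
    rintro rfl
    have : δ = 0 := by nlinarith [sq_nonneg α, sq_nonneg δ]
    omega
  have htr : PythagoreanTriple δ (2 * α) |γ| := by
    unfold PythagoreanTriple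
    rw [abs_mul_abs_self]
    linear_combination h2
  have hcop2 : IsCoprime δ (2 * α) :=
    IsCoprime.mul_right (Int.isCoprime_two_right.mpr (Int.odd_iff.mpr hδ)) hcop.symm
  obtain ⟨m, n, e1, e2, -, hmn, hpar, -⟩ := htr.coprime_classification'
    (Int.isCoprime_iff_gcd_eq_one.mp hcop2) hδ (abs_pos.mpr hγ)
  have hα : α = m * n := by linarith
  exact ⟨m, n, hα, Int.isCoprime_iff_gcd_eq_one.mpr hmn, hpar, by
    rw [← h1, hα, e1]; ring⟩

/-- If `β²(4α² + δ²) = γ²(α² + δ²)` with `(α, δ)` and `(β, γ)` coprime, then the factors match. -/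
theorem sq_add_sq_of_mul_eq {α β γ δ : ℤ} (hαδ : IsCoprime α δ) (hβγ : IsCoprime β γ) (hδ : δ ≠ 0)
    (h : β ^ 2 * (4 * α ^ 2 + δ ^ 2) = γ ^ 2 * (α ^ 2 + δ ^ 2)) :
    α ^ 2 + δ ^ 2 = β ^ 2 ∧ 4 * α ^ 2 + δ ^ 2 = γ ^ 2 := by
  have hδ2 : 0 < δ ^ 2 := by positivity
  have hb : β ^ 2 ∣ α ^ 2 + δ ^ 2 :=
    (hβγ.pow (m := 2) (n := 2)).dvd_of_dvd_mul_left ⟨_, h.symm⟩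
  obtain ⟨k, hk⟩ := hb
  have hβ : β ^ 2 ≠ 0 := by
    intro h0
    rw [h0] at hk
    nlinarith [sq_nonneg α]
  have hk2 : 4 * α ^ 2 + δ ^ 2 = γ ^ 2 * k := by
    apply mul_left_cancel₀ hβ
    rw [h, hk]; ring
  have h3 : k ∣ 3 := by
    have hα : k ∣ 3 * α ^ 2 := ⟨γ ^ 2 - β ^ 2, by linear_combination hk2 - hk⟩
    have hδ' : k ∣ 3 * δ ^ 2 := ⟨4 * β ^ 2 - γ ^ 2, by linear_combination 4 * hk - hk2⟩
    obtain ⟨u, v, huv⟩ := hαδ.pow (m := 2) (n := 2)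
    have : (3 : ℤ) = u * (3 * α ^ 2) + v * (3 * δ ^ 2) := by linear_combination -3 * huv
    rw [this]
    exact dvd_add (hα.mul_left _) (hδ'.mul_left _)
  have hk0 : 0 < k := by
    by_contra hk0
    nlinarith [sq_nonneg α, sq_nonneg β]
  have hk1 : k = 1 := by
    have hle := Int.le_of_dvd (by norm_num) h3
    have : k = 1 ∨ k = 2 ∨ k = 3 := by omega
    rcases this with rfl | rfl | rfl
    · rfl
    · omega
    -- -1 is not a square modulo 3, so 3 would divide both α and δ.
    · exfalso
      have hs : ((α : ZMod 3)) ^ 2 + (δ : ZMod 3) ^ 2 = 0 := by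
        have := congrArg (Int.cast : ℤ → ZMod 3) hk
        push_cast at this
        rw [this, show (3 : ZMod 3) = 0 from rfl, mul_zero]
      have key : ∀ a b : ZMod 3, a ^ 2 + b ^ 2 = 0 → a = 0 ∧ b = 0 := by decide
      obtain ⟨ha, hb⟩ := key _ _ hs
      have ha' : (3 : ℤ) ∣ α := (ZMod.intCast_zmod_eq_zero_iff_dvd α 3).mp ha
      have hb' : (3 : ℤ) ∣ δ := (ZMod.intCast_zmod_eq_zero_iff_dvd δ 3).mp hb
      have := hαδ.isUnit_of_dvd' ha' hb'
      rw [Int.isUnit_iff] at this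
      omega
  subst hk1
  constructor <;> linarith

theorem isCoprime_sq_sub_sq_mul {x y : ℤ} (hc : IsCoprime x y) :
    IsCoprime (x ^ 2 - y ^ 2) (x * y) := by
  apply IsCoprime.mul_right
  · have : IsCoprime (-y ^ 2) x := (hc.symm.pow_left (m := 2)).neg_left
    simpa [sub_eq_add_neg, sq, add_comm] using this.add_mul_left_left x
  · have : IsCoprime (x ^ 2) y := hc.pow_left
    simpa [sub_eq_add_neg, sq] using this.add_mul_left_left (-y)

/-- One step of infinite descent for `x⁴ - x²y² + y⁴ = z²`. -/
theorem quartic_descent {x y z : ℤ} (hx0 : x ≠ 0) (hx : x % 2 = 0) (hy : y % 2 = 1)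
    (hc : IsCoprime x y) (h : x ^ 4 - x ^ 2 * y ^ 2 + y ^ 4 = z ^ 2) :
    ∃ p q w : ℤ, p ≠ 0 ∧ p % 2 = 0 ∧ q % 2 = 1 ∧ IsCoprime p q ∧
      p ^ 4 - p ^ 2 * q ^ 2 + q ^ 4 = w ^ 2 ∧ (p * q).natAbs < (x * y).natAbs := by
  have hy0 : y ≠ 0 := by omega
  have hxy : (x ^ 2 - y ^ 2) % 2 = 1 := by
    have e1 : Even (x ^ 2) := (Int.even_iff.mpr hx).pow_of_ne_zero two_ne_zero
    have e2 : Odd (y ^ 2) := (Int.odd_iff.mpr hy).pow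
    exact Int.odd_iff.mp (e1.sub_odd e2)
  -- x⁴ - x²y² + y⁴ = (x² - y²)² + (xy)².
  have htr : PythagoreanTriple (x ^ 2 - y ^ 2) (x * y) |z| := by
    unfold PythagoreanTriple
    rw [abs_mul_abs_self]
    linear_combination h
  have hz : z ≠ 0 := by
    rintro rfl
    have : (x ^ 2 - y ^ 2) ^ 2 + (x * y) ^ 2 = 0 := by linear_combination h
    have h0 : x * y = 0 := by nlinarith [sq_nonneg (x ^ 2 - y ^ 2), sq_nonneg (x * y)]
    exact (mul_ne_zero hx0 hy0) h0
  have hcop := isCoprime_sq_sub_sq_mul hc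
  obtain ⟨m, n, e1, e2, -, hmn, hpar, -⟩ := htr.coprime_classification'
    (Int.isCoprime_iff_gcd_eq_one.mp hcop) hxy (abs_pos.mpr hz)
  rw [← Int.isCoprime_iff_gcd_eq_one] at hmn
  obtain ⟨x', rfl⟩ : (2 : ℤ) ∣ x := Int.dvd_of_emod_eq_zero hx
  have hmul : x' * y = m * n := by linarith
  -- Common refinement of the two factorisations of x'y = mn: x' = αβ, y = γδ, m = αγ, n = βδ.
  obtain ⟨α, γ, ⟨β, rfl⟩, ⟨δ, rfl⟩, rfl⟩ := exists_dvd_and_dvd_of_dvd_mul (Dvd.intro n hmul.symm)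
  have hm0 : α * γ ≠ 0 := by
    intro h0
    rcases mul_eq_zero.mp h0 with h0 | h0 <;> simp [h0] at hx0 hy0
  obtain rfl : n = β * δ := by
    apply mul_left_cancel₀ hm0
    rw [← hmul]; ring
  have hαδ : IsCoprime α δ := (hmn.of_mul_left_left).of_mul_right_right
  have hβγ : IsCoprime β γ := (hmn.of_mul_left_right).of_mul_right_left.symm
  have hδ : δ % 2 = 1 := by
    rw [← Int.odd_iff] at hy ⊢
    exact (Int.odd_mul.mp hy).2
  obtain ⟨h1, h2⟩ := sq_add_sq_of_mul_eq hαδ hβγ (by omega)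
    (by linear_combination e1)
  obtain ⟨p, q, rfl, hpq, hpq2, hq⟩ := exists_quartic_of_sq_add_sq hδ hαδ h1 h2
  have hlt : (p * q).natAbs < (2 * (p * q * β) * (γ * δ)).natAbs := by
    simp only [ne_eq, mul_eq_zero, not_or] at hx0 hy0
    have hb := Int.natAbs_pos.mpr hx0.2.2
    have hg := Int.natAbs_pos.mpr hy0.1
    have hd := Int.natAbs_pos.mpr hy0.2
    have hpq0 : 0 < (p * q).natAbs := Int.natAbs_pos.mpr (mul_ne_zero hx0.2.1.1 hx0.2.1.2)
    have : (2 * (p * q * β) * (γ * δ)).natAbs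
        = (p * q).natAbs * (2 * (β.natAbs * γ.natAbs * δ.natAbs)) := by
      simp only [Int.natAbs_mul, Int.reduceAbs]; ring
    rw [this]
    have h1 : 0 < β.natAbs * γ.natAbs * δ.natAbs := by positivity
    exact lt_mul_of_one_lt_right hpq0 (by omega)
  have hp0 : p ≠ 0 ∧ q ≠ 0 := by
    simp only [ne_eq, mul_eq_zero, not_or] at hx0
    exact hx0.2.1
  rcases hpq2 with ⟨hp2, hq2⟩ | ⟨hp2, hq2⟩
  · exact ⟨p, q, β, hp0.1, hp2, hq2, hpq, hq, hlt⟩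
  · exact ⟨q, p, β, hp0.2, hq2, hp2, hpq.symm, by rw [← hq]; ring, by rwa [mul_comm q p]⟩

theorem quartic_even_eq_zero (N : ℕ) : ∀ x y z : ℤ, (x * y).natAbs = N → x % 2 = 0 → y % 2 = 1 →
    IsCoprime x y → x ^ 4 - x ^ 2 * y ^ 2 + y ^ 4 = z ^ 2 → x = 0 := by
  induction N using Nat.strong_induction_on with
  | _ N ih =>
    rintro x y z rfl hx hy hc h
    by_contra hx0
    obtain ⟨p, q, w, hp0, hp, hq, hpq, hw, hlt⟩ := quartic_descent hx0 hx hy hc h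
    exact hp0 (ih _ hlt p q w rfl hp hq hpq hw)

/-- The coprime solutions of `x⁴ - x²y² + y⁴ = z²` are trivial. -/
theorem quartic_trivial_of_isCoprime {x y z : ℤ} (hc : IsCoprime x y)
    (h : x ^ 4 - x ^ 2 * y ^ 2 + y ^ 4 = z ^ 2) : x = 0 ∨ y = 0 ∨ x ^ 2 = y ^ 2 := by
  rcases Int.emod_two_eq_zero_or_one x with hx | hx <;>
    rcases Int.emod_two_eq_zero_or_one y with hy | hy
  · have := hc.isUnit_of_dvd' (Int.dvd_of_emod_eq_zero hx) (Int.dvd_of_emod_eq_zero hy)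
    rw [Int.isUnit_iff] at this
    omega
  · exact .inl (quartic_even_eq_zero _ x y z rfl hx hy hc h)
  · exact .inr (.inl (quartic_even_eq_zero _ y x z rfl hy hx hc.symm (by rw [← h]; ring)))
  · right; right
    have hodd : (x * y) % 2 = 1 := by
      rw [← Int.odd_iff] at *
      exact hx.mul hy
    have htr : PythagoreanTriple (x * y) (x ^ 2 - y ^ 2) |z| := by
      unfold PythagoreanTriple
      rw [abs_mul_abs_self]
      linear_combination h
    have hz : z ≠ 0 := by
      rintro rfl
      have h0 : x * y = 0 := by nlinarith [sq_nonneg (x ^ 2 - y ^ 2), sq_nonneg (x * y)]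
      omega
    have hcop := (isCoprime_sq_sub_sq_mul hc).symm
    obtain ⟨m, n, e1, e2, -, hmn, hpar, -⟩ := htr.coprime_classification'
      (Int.isCoprime_iff_gcd_eq_one.mp hcop) hodd (abs_pos.mpr hz)
    rw [← Int.isCoprime_iff_gcd_eq_one] at hmn
    obtain ⟨s, hs⟩ : (2 : ℤ) ∣ x ^ 2 + y ^ 2 := by
      rw [← even_iff_two_dvd]
      exact (Int.odd_iff.mpr hx).pow.add_odd (Int.odd_iff.mpr hy).pow
    -- With s = (x² + y²)/2, s² = (xy)² + ((x² - y²)/2)² = (m² - n²)² + (mn)². As m and n have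
    -- opposite parity, the even case applies.
    have hs2 : m ^ 4 - m ^ 2 * n ^ 2 + n ^ 4 = s ^ 2 := by
      have : (2 * s) ^ 2 = 4 * (m ^ 4 - m ^ 2 * n ^ 2 + n ^ 4) := by
        rw [← hs]
        linear_combination 4 * (x * y + (m ^ 2 - n ^ 2)) * e1 + (x ^ 2 - y ^ 2 + 2 * m * n) * e2
      linarith
    have hmn0 : m = 0 ∨ n = 0 := by
      rcases hpar with ⟨hm, hn⟩ | ⟨hm, hn⟩
      · exact .inl (quartic_even_eq_zero _ m n s rfl hm hn hmn hs2)
      · exact .inr (quartic_even_eq_zero _ n m s rfl hn hm hmn.symm (by rw [← hs2]; ring))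
    rcases hmn0 with h0 | h0 <;> rw [h0] at e2 <;> linarith

/-- The rational points on `z² = τ⁴ - τ² + 1` are trivial. -/
theorem rat_quartic_trivial {τ z : ℚ} (h : τ ^ 4 - τ ^ 2 + 1 = z ^ 2) : τ = 0 ∨ τ ^ 2 = 1 := by
  have hd : (τ.den : ℚ) ≠ 0 := by exact_mod_cast τ.den_nz
  have hτ : τ * τ.den = τ.num := Rat.mul_den_eq_num τ
  have key : ((τ.num ^ 4 - τ.num ^ 2 * (τ.den : ℤ) ^ 2 + (τ.den : ℤ) ^ 4 : ℤ) : ℚ)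
      = (z * τ.den ^ 2) ^ 2 := by
    push_cast
    rw [← hτ]
    linear_combination (τ.den : ℚ) ^ 4 * h
  obtain ⟨w, hw⟩ := Rat.isSquare_intCast_iff.mp (key ▸ IsSquare.sq (z * (τ.den : ℚ) ^ 2))
  rw [← sq] at hw
  rcases quartic_trivial_of_isCoprime (Rat.isCoprime_num_den τ) hw with h0 | h0 | h0
  · exact .inl (Rat.num_eq_zero.mp h0)
  · exact absurd (by exact_mod_cast h0) τ.den_nz
  · right
    have h0' : (τ.num : ℚ) ^ 2 = (τ.den : ℚ) ^ 2 := by exact_mod_cast h0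
    rw [← hτ] at h0'
    have : (τ ^ 2 - 1) * (τ.den : ℚ) ^ 2 = 0 := by linear_combination h0'
    rcases mul_eq_zero.mp this with h1 | h1
    · linarith
    · exact absurd h1 (pow_ne_zero 2 hd)

/-- The affine rational points on `y² = x(x + 3)(x - 1)` are the seven torsion points. -/
theorem rat_points_trivial {x y : ℚ} (h : y ^ 2 = x * (x + 3) * (x - 1)) :
    (x = 0 ∨ x = -3 ∨ x = 1) ∨ x = 3 ∨ x = -1 := by
  by_cases hy : y = 0
  · left
    rw [hy] at h
    have : x * (x + 3) * (x - 1) = 0 := by linarith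
    rcases mul_eq_zero.mp this with h1 | h1
    · rcases mul_eq_zero.mp h1 with h2 | h2
      · exact .inl h2
      · right; left; linarith
    · right; right; linarith
  · right
    have hne : x * (x + 3) * (x - 1) ≠ 0 := h ▸ pow_ne_zero 2 hy
    have hx : x ≠ 0 := fun h0 => hne (by simp [h0])
    have hg : (x + 3) * (x - 1) ≠ 0 := fun h0 => hne (by rw [mul_assoc, h0, mul_zero])
    -- τ = (x + 3)(x - 1)/(2y), z = (x² + 3)/(4x) is a birational map to z² = τ⁴ - τ² + 1, with x =
    -- 2τ² + 2z - 1.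
    have hτ2 : ((x + 3) * (x - 1) / (2 * y)) ^ 2 = (x + 3) * (x - 1) / (4 * x) := by
      rw [div_pow, mul_pow 2 y, h]
      field_simp
      ring
    have key : ((x + 3) * (x - 1) / (2 * y)) ^ 4 - ((x + 3) * (x - 1) / (2 * y)) ^ 2 + 1
        = ((x ^ 2 + 3) / (4 * x)) ^ 2 := by
      rw [show (4 : ℕ) = 2 * 2 from rfl, pow_mul, hτ2]
      field_simp
      ring
    rcases rat_quartic_trivial key with h0 | h0
    · exact absurd h0 (div_ne_zero hg (by positivity))
    · rw [hτ2, div_eq_one_iff_eq (by positivity)] at h0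
      have : (x - 3) * (x + 1) = 0 := by linear_combination h0
      rcases mul_eq_zero.mp this with h1 | h1
      · left; linarith
      · right; linarith

/-! ### Progressions of four squares and points of the curve -/

open Polynomial in
theorem finite_setOf_monic_cubic_eq_zero {K : Type*} [Field K] (a b c : K) :
    {x : K | x ^ 3 + a * x ^ 2 + b * x + c = 0}.Finite := by
  have hp : (X ^ 3 + (C a * X ^ 2 + C b * X + C c) : K[X]).Monic :=
    monic_X_pow_add (lt_of_le_of_lt degree_quadratic_le (by decide))
  refine (finite_setOfPred_isRoot hp.ne_zero).subset fun x hx => ?_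
  simpa [IsRoot, ← add_assoc] using hx

open Polynomial in
theorem finite_setOf_monic_quartic_eq_zero {K : Type*} [Field K] (a b c e : K) :
    {x : K | x ^ 4 + a * x ^ 3 + b * x ^ 2 + c * x + e = 0}.Finite := by
  have hp : (X ^ 4 + (C a * X ^ 3 + C b * X ^ 2 + C c * X + C e) : K[X]).Monic :=
    monic_X_pow_add (lt_of_le_of_lt degree_cubic_le (by decide))
  refine (finite_setOfPred_isRoot hp.ne_zero).subset fun x hx => ?_
  simpa [IsRoot, ← add_assoc] using hx

section

variable {K : Type*} [Field K] [CharZero K]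

/-- A nonconstant progression of four squares yields a point of `y² = x(x + 3)(x - 1)` outside the
rational torsion. -/
theorem IsNonconstFourSquareAP.exists_point {s : Fin 4 → K} (h : IsNonconstFourSquareAP s) :
    ∃ x y : K, y ^ 2 = x * (x + 3) * (x - 1) ∧
      ¬((x = 0 ∨ x = -3 ∨ x = 1) ∨ x = 3 ∨ x = -1) := by
  obtain ⟨⟨r, hr, hs⟩, hsq⟩ := h
  obtain ⟨a, ha⟩ := hsq 0
  obtain ⟨b, hb⟩ := hsq 1
  obtain ⟨c, hc⟩ := hsq 2
  obtain ⟨e, he⟩ := hsq 3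
  have h1 := hs 1
  have h2 := hs 2
  have h3 := hs 3
  rw [ha, hb] at h1
  rw [ha, hc] at h2
  rw [ha, he] at h3
  norm_num at h1 h2 h3
  -- This is the denominator of t = (c - a)/(2b - a - c).
  have hk : 2 * b - a - c ≠ 0 := by
    intro h0
    have : (a - c) ^ 2 = 0 := by
      linear_combination 2 * h2 - 4 * h1 + (2 * b + a + c) * h0
    have hac : a - c = 0 := by simpa using this
    apply hr
    have h2r : 2 * r = 0 := by linear_combination -h2 - (a + c) * hac
    simpa using h2r
  obtain ⟨k, hk4⟩ : ∃ k, 2 * b - a - c = 4 * k := ⟨(2 * b - a - c) / 4, by ring⟩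
  have hk0 : k ≠ 0 := by rintro rfl; exact hk (by rw [hk4, mul_zero])
  obtain ⟨t, ht⟩ : ∃ t, c - a = t * (4 * k) := ⟨(c - a) / (4 * k), by field_simp⟩
  obtain ⟨f, rfl⟩ : ∃ f, e = k * f := ⟨e / k, by field_simp⟩
  have hac : a + c = 2 * k * (t ^ 2 - 1) := by
    have : 8 * k * (a + c) = 8 * k * (2 * k * (t ^ 2 - 1)) := by
      linear_combination 4 * h1 - 2 * h2 + (c - a + 4 * t * k) * ht
        - (2 * (a + c) + (2 * b - a - c) + 4 * k) * hk4
    exact mul_left_cancel₀ (mul_ne_zero (by norm_num) hk0) this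
  have hb' : b = k * (t ^ 2 + 1) := by linear_combination hk4 / 2 + hac / 2
  have ha' : a = k * (t ^ 2 - 2 * t - 1) := by linear_combination hac / 2 - ht / 2
  have hc' : c = k * (t ^ 2 + 2 * t - 1) := by linear_combination hac / 2 + ht / 2
  subst ha' hb' hc'
  have hf : f ^ 2 = t ^ 4 + 8 * t ^ 3 + 2 * t ^ 2 - 8 * t + 1 := by
    apply mul_left_cancel₀ (pow_ne_zero 2 hk0)
    linear_combination h3 - 3 * h1
  have hr' : r = k ^ 2 * (4 * t * (t - 1) * (t + 1)) := by linear_combination -h1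
  have ht0 : t ≠ 0 := by rintro rfl; exact hr (by rw [hr']; ring)
  have ht1 : t - 1 ≠ 0 := by intro h0; exact hr (by rw [hr', h0]; ring)
  have ht2 : t + 1 ≠ 0 := by intro h0; exact hr (by rw [hr', h0]; ring)
  -- The quartic is (t² + 4t - 1)² - 12t², so this substitution leaves (3 - x)t² - 4xt + x² + x = 0,
  -- whose quarter discriminant in t is x(x + 3)(x - 1). Each excluded x makes this equation force t
  -- ∈ {0, 1, -1}, where r = 0.
  obtain ⟨x, rfl⟩ : ∃ x, f = t ^ 2 + 4 * t - 1 - 2 * x := ⟨(t ^ 2 + 4 * t - 1 - f) / 2, by ring⟩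
  refine ⟨x, t * (3 - x) - 2 * x, by linear_combination (3 - x) / 4 * hf, ?_⟩
  rintro ((rfl | rfl | rfl) | rfl | rfl)
  · exact mul_ne_zero (mul_ne_zero (by norm_num : (12 : K) ≠ 0) ht0) ht0
      (by linear_combination hf)
  · exact mul_ne_zero (mul_ne_zero (by norm_num : (24 : K) ≠ 0) ht2) ht2
      (by linear_combination hf)
  · exact mul_ne_zero (mul_ne_zero (by norm_num : (8 : K) ≠ 0) ht1) ht1
      (by linear_combination hf)
  · exact mul_ne_zero (by norm_num : (48 : K) ≠ 0) ht1 (by linear_combination -hf)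
  · exact mul_ne_zero (mul_ne_zero (by norm_num : (16 : K) ≠ 0) ht0) ht2
      (by linear_combination hf)

/-- The progression of four squares attached to a point of `y² = x(x + 3)(x - 1)`, where
`t = (2x + y) / (3 - x)`. -/
theorem isNonconstFourSquareAP_of_point {x y t : K} (h : y ^ 2 = x * (x + 3) * (x - 1))
    (hx : x ≠ 3) (hy : y = t * (3 - x) - 2 * x) (ht : t ^ 3 - t ≠ 0) :
    IsNonconstFourSquareAP ![(t ^ 2 - 2 * t - 1) ^ 2, (t ^ 2 + 1) ^ 2, (t ^ 2 + 2 * t - 1) ^ 2,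
      (t ^ 2 + 4 * t - 1 - 2 * x) ^ 2] := by
  have hf : (t ^ 2 + 4 * t - 1 - 2 * x) ^ 2 = t ^ 4 + 8 * t ^ 3 + 2 * t ^ 2 - 8 * t + 1 := by
    have h3 : 3 - x ≠ 0 := sub_ne_zero.mpr hx.symm
    apply mul_left_cancel₀ h3
    subst hy
    linear_combination 4 * h
  refine ⟨⟨4 * (t ^ 3 - t), mul_ne_zero (by norm_num) ht, ?_⟩, ?_⟩
  · intro i
    fin_cases i
    · simp
    · simp
      ring
    · simp
      ring
    · simp only [Fin.reduceFinMk, Matrix.cons_val]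
      rw [hf]
      norm_num
      ring
  · intro i
    fin_cases i <;> exact IsSquare.sq _

/-- The ratio is unchanged by scaling, so it can be read off any representative of a class. -/
theorem finite_setOf_ratio {K : Type*} [Field K] (hfin : (fourSquareAPClasses K).Finite) :
    {u : K | ∃ s : Fin 4 → K, IsNonconstFourSquareAP s ∧ u = s 0 / (s 1 - s 0)}.Finite := by
  refine (hfin.image fun P => P.rep 0 / (P.rep 1 - P.rep 0)).subset ?_
  rintro u ⟨s, hs, rfl⟩
  have hs0 : s ≠ 0 := by
    rintro rfl
    obtain ⟨⟨r, hr, h⟩, -⟩ := hs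
    exact hr (by simpa using (h 1).symm)
  refine ⟨_, ⟨s, hs0, hs, rfl⟩, ?_⟩
  obtain ⟨a, ha⟩ := Projectivization.exists_smul_eq_mk_rep K s hs0
  simp only [← ha, Pi.smul_apply, Units.smul_def, smul_eq_mul, ← mul_sub]
  exact mul_div_mul_left _ _ a.ne_zero

/-- Infinitely many points of `y² = x(x + 3)(x - 1)` give infinitely many classes of
progressions. -/
theorem fourSquareAPClasses_infinite {S : Set (K × K)} (hS : S.Infinite)
    (h : ∀ p ∈ S, p.2 ^ 2 = p.1 * (p.1 + 3) * (p.1 - 1)) : (fourSquareAPClasses K).Infinite := by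
  intro hfin
  have hU := finite_setOf_ratio hfin
  set U := {u : K | ∃ s : Fin 4 → K, IsNonconstFourSquareAP s ∧ u = s 0 / (s 1 - s 0)}
  have hT : ({t : K | t ^ 3 - t = 0} ∪
      ⋃ u ∈ U, {t : K | (t ^ 2 - 2 * t - 1) ^ 2 = u * (4 * (t ^ 3 - t))}).Finite := by
    refine Set.Finite.union ?_ (hU.biUnion fun u _ => ?_)
    · refine (finite_setOf_monic_cubic_eq_zero 0 (-1) 0).subset fun t ht => ?_
      simp only [Set.mem_ofPred_eq] at ht ⊢
      linear_combination ht
    · refine (finite_setOf_monic_quartic_eq_zero (-4 - 4 * u) 2 (4 + 4 * u) 1).subset ?_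
      intro t ht
      simp only [Set.mem_ofPred_eq] at ht ⊢
      linear_combination ht
  -- The lines y = t(3 - x) - 2x pass through (3, -6). Points with x ≠ 3 lie on one of them, and
  -- each line meets the curve in finitely many points; x = 3 leaves only y = ±6.
  refine hS ((((Set.finite_singleton (6 : K)).insert (-6)).image (Prod.mk 3)).union
    (hT.biUnion fun t _ => (finite_setOf_monic_cubic_eq_zero (2 - (t + 2) ^ 2) (6 * t * (t + 2) - 3)
      (-9 * t ^ 2)).image fun x => (x, t * (3 - x) - 2 * x)) |>.subset ?_)
  rintro ⟨x, y⟩ hp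
  have hxy := h _ hp
  simp only at hxy
  by_cases hx : x = 3
  · left
    subst hx
    have : (y - 6) * (y + 6) = 0 := by linear_combination hxy
    rcases mul_eq_zero.mp this with h1 | h1
    · exact ⟨6, by simp, by rw [sub_eq_zero.mp h1]⟩
    · exact ⟨-6, by simp, by rw [eq_neg_of_add_eq_zero_left h1]⟩
  · right
    have h3 : 3 - x ≠ 0 := sub_ne_zero.mpr (Ne.symm hx)
    obtain ⟨t, rfl⟩ : ∃ t, y = t * (3 - x) - 2 * x := ⟨(y + 2 * x) / (3 - x), by field_simp; ring⟩
    refine Set.mem_biUnion (x := t) ?_ ⟨x, ?_, rfl⟩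
    · by_cases ht : t ^ 3 - t = 0
      · exact .inl ht
      · right
        refine Set.mem_biUnion ⟨_, isNonconstFourSquareAP_of_point hxy hx rfl ht, rfl⟩ ?_
        have h4 : 4 * (t ^ 3 - t) ≠ 0 := mul_ne_zero (by norm_num) ht
        simp only [Set.mem_ofPred_eq, Matrix.cons_val_zero, Matrix.cons_val_one]
        rw [show (t ^ 2 + 1) ^ 2 - (t ^ 2 - 2 * t - 1) ^ 2 = 4 * (t ^ 3 - t) by ring,
          div_mul_cancel₀ _ h4]
    · simp only [Set.mem_ofPred_eq]
      linear_combination -hxy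

end

/-! ### 2-adic behaviour of duplication -/

/-- `x'` is the abscissa of the double of a point with abscissa `x` that is not of order two on a
twist of `y² = x(x + 3)(x - 1)`. -/
def IsDouble (x x' : ℚ) : Prop :=
  x * (x + 3) * (x - 1) ≠ 0 ∧ x' * (4 * (x * (x + 3) * (x - 1))) = (x ^ 2 + 3) ^ 2

/-- The rational number `x` has `2`-adic valuation `-n`. -/
def HasTwoPole (n : ℕ) (x : ℚ) : Prop :=
  ∃ p q : ℤ, Odd p ∧ Odd q ∧ x * (2 ^ n * q) = p

theorem HasTwoPole.le_of_eq {m n : ℕ} {x : ℚ} (hm : HasTwoPole m x) (hn : HasTwoPole n x) :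
    m ≤ n := by
  by_contra! hlt
  obtain ⟨k, rfl⟩ := Nat.exists_eq_add_of_lt hlt
  obtain ⟨p, q, hp, hq, h1⟩ := hm
  obtain ⟨p', q', hp', hq', h2⟩ := hn
  have hq0 : (q' : ℚ) ≠ 0 := by
    have : q' ≠ 0 := by rintro rfl; simp at hq'
    exact_mod_cast this
  have key : ((2 ^ (k + 1) * (q * p') : ℤ) : ℚ) = ((p * q' : ℤ) : ℚ) := by
    push_cast
    rw [← h1, ← h2, pow_add, pow_add, pow_add]
    ring
  have key' : 2 ^ (k + 1) * (q * p') = p * q' := by exact_mod_cast key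
  have hodd : Odd (p * q') := hp.mul hq'
  rw [← key'] at hodd
  simp only [Int.odd_mul, Int.odd_pow'  k.succ_ne_zero] at hodd
  exact absurd hodd.1 (by decide)

theorem exists_hasTwoPole {x : ℚ} {p z : ℤ} (hp : Odd p) (hz : z ≠ 0) (h : x * (2 * z) = p) :
    ∃ n, 1 ≤ n ∧ HasTwoPole n x := by
  obtain ⟨m, hzm, hm⟩ := FiniteMultiplicity.exists_eq_pow_mul_and_not_dvd
    (a := 2) (Int.finiteMultiplicity_iff.mpr ⟨by decide, hz⟩)
  generalize multiplicity (2 : ℤ) z = k at hzm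
  subst hzm
  refine ⟨k + 1, by omega, p, m, hp, ?_, ?_⟩
  · rwa [← Int.not_even_iff_odd, even_iff_two_dvd]
  · rw [← h]; push_cast; ring

/-- When x has a pole, x² dominates in x² + 3 and x³ in x(x + 3)(x - 1), so x' has the valuation of
x/4. -/
theorem HasTwoPole.isDouble {n : ℕ} (hn : 1 ≤ n) {x x' : ℚ} (h : HasTwoPole n x)
    (hd : IsDouble x x') : HasTwoPole (n + 2) x' := by
  obtain ⟨p, q, hp, hq, h1⟩ := h
  obtain ⟨hne, h2⟩ := hd
  have hN : Even ((2 : ℤ) ^ n) := (by decide : Even (2 : ℤ)).pow_of_ne_zero (by omega)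
  refine ⟨(p ^ 2 + 3 * (2 ^ n * q) ^ 2) ^ 2, p * q * (p + 3 * (2 ^ n * q)) * (p - 2 ^ n * q),
    ?_, ?_, ?_⟩
  · refine (hp.pow.add_even (((hN.mul_right q).pow_of_ne_zero two_ne_zero).mul_left 3)).pow
  · exact ((hp.mul hq).mul (hp.add_even ((hN.mul_right q).mul_left 3))).mul
      (hp.sub_even (hN.mul_right q))
  · push_cast
    rw [← h1, pow_add]
    linear_combination (2 ^ n * (q : ℚ)) ^ 4 * h2

theorem IsDouble.of_div {x x' : ℚ} (hd : IsDouble x x') {p q : ℤ} (hq : q ≠ 0)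
    (hx : x * q = p) : p * (p + 3 * q) * (p - q) ≠ 0 ∧
      x' * (4 * (p * q * (p + 3 * q) * (p - q) : ℤ)) = ((p ^ 2 + 3 * q ^ 2) ^ 2 : ℤ) := by
  obtain ⟨hne, h2⟩ := hd
  have hq' : (q : ℚ) ≠ 0 := by exact_mod_cast hq
  constructor
  · have : ((p * (p + 3 * q) * (p - q) : ℤ) : ℚ) = q ^ 3 * (x * (x + 3) * (x - 1)) := by
      push_cast
      rw [← hx]
      ring
    intro h0
    rw [h0, Int.cast_zero] at this
    exact mul_ne_zero (pow_ne_zero 3 hq') hne this.symm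
  · push_cast
    rw [← hx]
    linear_combination (q : ℚ) ^ 4 * h2

/-- The double of a point whose abscissa is `1` modulo `4` has a `2`-adic pole. -/
theorem IsDouble.exists_hasTwoPole_of_sub {x x' : ℚ} (hd : IsDouble x x') {p q : ℤ}
    (hq : Odd q) (hx : x * q = p) (hpq : (4 : ℤ) ∣ p - q) : ∃ n, 1 ≤ n ∧ HasTwoPole n x' := by
  have hq0 : q ≠ 0 := by rintro rfl; simp at hq
  obtain ⟨h1, h2⟩ := hd.of_div hq0 hx
  obtain ⟨w, hw⟩ := hpq
  obtain rfl : p = 4 * w + q := by linarith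
  have hodd : Odd (4 * w ^ 2 + 2 * w * q + q ^ 2) :=
    Even.add_odd ⟨2 * w ^ 2 + w * q, by ring⟩ hq.pow
  refine exists_hasTwoPole (hodd.pow (n := 2)) (z := 2 * ((4 * w + q) * q * (w + q) * w)) ?_ ?_
  · intro h0
    apply h1
    have : (4 * w + q) * (w + q) * w = 0 := by
      apply mul_left_cancel₀ (mul_ne_zero two_ne_zero hq0)
      rw [mul_zero, ← h0]; ring
    linear_combination 16 * this
  · push_cast at h2 ⊢
    linear_combination h2 / 16

/-- Doubling twice yields an abscissa with a `2`-adic pole. -/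
theorem IsDouble.exists_hasTwoPole_of_isDouble {x x₁ x₂ : ℚ} (h1 : IsDouble x x₁)
    (h2 : IsDouble x₁ x₂) :
    ∃ n, 1 ≤ n ∧ HasTwoPole n x₂ := by
  suffices h : (∃ n, 1 ≤ n ∧ HasTwoPole n x₁) ∨
      ∃ p q : ℤ, Odd q ∧ x₁ * q = p ∧ (4 : ℤ) ∣ p - q by
    rcases h with ⟨n, hn, h⟩ | ⟨p, q, hq, hx, hpq⟩
    · exact ⟨n + 2, by omega, h.isDouble hn h2⟩
    · exact h2.exists_hasTwoPole_of_sub hq hx hpq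
  have hx : x * (x.den : ℤ) = x.num := by exact_mod_cast Rat.mul_den_eq_num x
  have hcop : IsCoprime x.num (x.den : ℤ) := Rat.isCoprime_num_den x
  have hq0 : (x.den : ℤ) ≠ 0 := by exact_mod_cast x.den_nz
  obtain ⟨hne, h3⟩ := h1.of_div hq0 hx
  generalize x.num = p at *
  generalize (x.den : ℤ) = q at *
  rcases Int.even_or_odd p with hp | hp <;> rcases Int.even_or_odd q with hq | hq
  · have := hcop.isUnit_of_dvd' hp.two_dvd hq.two_dvd
    rw [Int.isUnit_iff] at this
    omega
  · left
    have hodd : Odd (p ^ 2 + 3 * q ^ 2) :=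
      (hp.pow_of_ne_zero two_ne_zero).add_odd ((by decide : Odd (3 : ℤ)).mul hq.pow)
    refine exists_hasTwoPole (hodd.pow (n := 2))
      (z := 2 * (p * q * (p + 3 * q) * (p - q))) ?_ ?_
    · refine mul_ne_zero two_ne_zero fun h0 => hne ?_
      apply mul_left_cancel₀ hq0
      rw [mul_zero, ← h0]; ring
    · rw [← h3]; push_cast; ring
  · left
    obtain ⟨r, hr⟩ := hq
    obtain rfl : q = 2 * r := by omega
    have hr0 : r ≠ 0 := by rintro rfl; simp at hq0
    obtain ⟨n, hn, h⟩ := exists_hasTwoPole (x := x) hp hr0 (by rw [← hx]; push_cast; ring)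
    exact ⟨n + 2, by omega, h.isDouble hn h1⟩
  -- For odd p and q, either x ≡ 1 mod 4 and one doubling creates a pole, or x ≡ 3 mod 4 and the
  -- double is 1 mod 4.
  · by_cases h4 : (4 : ℤ) ∣ p - q
    · exact .inl (h1.exists_hasTwoPole_of_sub hq hx h4)
    · right
      obtain ⟨u, hu⟩ := hp.sub_odd hq
      obtain rfl : p = q + 2 * u := by omega
      have hu' : Odd u := by
        rw [← Int.not_even_iff_odd]
        rintro ⟨v, rfl⟩
        exact h4 ⟨v, by ring⟩
      refine ⟨(q ^ 2 + q * u + u ^ 2) ^ 2, (q + 2 * u) * q * (2 * q + u) * u, ?_, ?_, ?_⟩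
      · exact ((hp.mul hq).mul (Even.add_odd (even_two_mul q) hu')).mul hu'
      · push_cast at h3 ⊢
        linear_combination h3 / 16
      · obtain ⟨a, rfl⟩ := hq
        obtain ⟨b, rfl⟩ := hu'
        ring_nf
        omega

/-! ### Duplication, torsion and rank on the twists -/

open WeierstrassCurve.Affine

/-- The equation of the curve with coefficients `(0, 2c, 0, -3c², 0)`. -/
theorem equation_iff_of_coeffs {F : Type*} [Field F] {W : WeierstrassCurve.Affine F} {c : F}
    (h₁ : W.a₁ = 0) (h₂ : W.a₂ = 2 * c) (h₃ : W.a₃ = 0) (h₄ : W.a₄ = -3 * c ^ 2) (h₆ : W.a₆ = 0)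
    (x y : F) : W.Equation x y ↔ y ^ 2 = x * (x + 3 * c) * (x - c) := by
  rw [equation_iff, h₁, h₂, h₃, h₄, h₆]
  constructor <;> intro h <;> linear_combination h

/-- Duplication on the curve `y² = x(x + 3c)(x - c)`. -/
theorem exists_add_self_eq_some {F : Type*} [Field F] [CharZero F] [DecidableEq F]
    {W : WeierstrassCurve.Affine F} {c : F} (h₁ : W.a₁ = 0) (h₂ : W.a₂ = 2 * c) (h₃ : W.a₃ = 0)
    (h₄ : W.a₄ = -3 * c ^ 2) (h₆ : W.a₆ = 0) {x y : F} (h : W.Nonsingular x y) (hy : y ≠ 0) :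
    ∃ (x' y' : F) (h' : W.Nonsingular x' y'), Point.some x y h + Point.some x y h = .some x' y' h' ∧
      x' = ((x ^ 2 + 3 * c ^ 2) / (2 * y)) ^ 2 ∧
      x' + 3 * c = ((x ^ 2 + 6 * c * x - 3 * c ^ 2) / (2 * y)) ^ 2 ∧
      x' - c = ((x ^ 2 - 2 * c * x - 3 * c ^ 2) / (2 * y)) ^ 2 := by
  have heq := (equation_iff_of_coeffs h₁ h₂ h₃ h₄ h₆ x y).mp h.left
  have hneg : W.negY x y = -y := by simp [negY, h₁, h₃]
  have hne : y ≠ W.negY x y := by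
    rw [hneg]
    intro h0
    exact hy (by linear_combination h0 / 2)
  refine ⟨_, _, _, Point.add_self_of_Y_ne hne, ?_⟩
  rw [slope_of_Y_ne rfl hne, addX, hneg, h₁, h₂, h₄, sub_neg_eq_add, ← two_mul]
  refine ⟨?_, ?_, ?_⟩ <;> field_simp
  · linear_combination (-8 * x - 8 * c) * heq
  · linear_combination (-8 * x + 4 * c) * heq
  · linear_combination (-8 * x - 12 * c) * heq

theorem Rat.not_isSquare_of_neg {a : ℚ} (h : a < 0) : ¬ IsSquare a := fun hs =>
  absurd hs.nonneg (not_le.mpr h)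

theorem isSquare_of_mul_self_mul {F : Type*} [Field F] {a b : F} (hb : b ≠ 0)
    (h : IsSquare (b * b * a)) : IsSquare a := by
  obtain ⟨r, hr⟩ := h
  exact ⟨r / b, by field_simp; linear_combination hr⟩

theorem eq_one_of_squarefree_of_isSquare {d : ℤ} (hd : Squarefree d) (h : IsSquare (d : ℚ)) :
    d = 1 := by
  obtain ⟨r, rfl⟩ := Rat.isSquare_intCast_iff.mp h
  rcases Int.isUnit_iff.mp (hd r dvd_rfl) with rfl | rfl <;> rfl

section Twist

variable {d : ℤ}

theorem twistE_equation (x y : ℚ) :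
    (twistE d).Equation x y ↔ y ^ 2 = x * (x + 3 * d) * (x - d) :=
  equation_iff_of_coeffs rfl rfl rfl rfl rfl x y

/-- On a nontrivial twist the double of a point not of order two is again not of order two. -/
theorem twistE_exists_add_self (hd : Squarefree d) (hd1 : d ≠ 1) {x y : ℚ}
    (h : (twistE d).Nonsingular x y) (hy : y ≠ 0) :
    ∃ (x' y' : ℚ) (h' : (twistE d).Nonsingular x' y'),
      Point.some x y h + Point.some x y h = .some x' y' h' ∧ y' ≠ 0 ∧ IsDouble (x / d) (x' / d) := by
  have hd0 : (d : ℚ) ≠ 0 := by exact_mod_cast hd.ne_zero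
  obtain ⟨x', y', h', hadd, e1, e2, e3⟩ :=
    exists_add_self_eq_some (c := (d : ℚ)) rfl rfl rfl rfl rfl h hy
  refine ⟨x', y', h', hadd, ?_, ?_⟩
  · rintro rfl
    have heq := (twistE_equation x' 0).mp h'.left
    have s1 : IsSquare x' := e1 ▸ IsSquare.sq _
    have s2 : IsSquare (x' + 3 * d) := e2 ▸ IsSquare.sq _
    have s3 : IsSquare (x' - d) := e3 ▸ IsSquare.sq _
    have h0 : x' * (x' + 3 * d) * (x' - d) = 0 := by linear_combination -heq
    -- All of x', x' + 3d, x' - d are squares. The roots 0, -3d, d would make -3d², 12d², d a square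
    -- respectively.
    rcases mul_eq_zero.mp h0 with h0 | h0
    · rcases mul_eq_zero.mp h0 with h0 | h0
      · subst h0
        have := s2.mul s3
        have hneg : (0 + 3 * (d : ℚ)) * (0 - d) < 0 := by
          have : 0 < (d : ℚ) ^ 2 := by positivity
          nlinarith
        exact Rat.not_isSquare_of_neg hneg this
      · obtain rfl : x' = -(3 * d) := by linarith
        have h12 : IsSquare (3 : ℚ) := by
          apply isSquare_of_mul_self_mul (b := 2 * (d : ℚ)) (by positivity)
          rw [show 2 * (d : ℚ) * (2 * d) * 3 = -(3 * d) * (-(3 * d) - d) by ring]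
          exact s1.mul s3
        norm_num at h12
    · obtain rfl : x' = d := by linarith
      exact hd1 (eq_one_of_squarefree_of_isSquare hd s1)
  · have heq := (twistE_equation x y).mp h.left
    have hfac : x / d * (x / d + 3) * (x / d - 1) = y ^ 2 / d ^ 3 := by
      rw [heq]; field_simp
    constructor
    · rw [hfac]
      exact div_ne_zero (pow_ne_zero 2 hy) (pow_ne_zero 3 hd0)
    · rw [hfac, e1]
      field_simp
      norm_num

/-- From the second doubling on, the order of the 2-adic pole rises by 2 each time, so the points
2ⁿP are distinct. -/
theorem twistE_not_isOfFinAddOrder (hd : Squarefree d) (hd1 : d ≠ 1) {x y : ℚ}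
    (h : (twistE d).Nonsingular x y) (hy : y ≠ 0) : ¬ IsOfFinAddOrder (Point.some x y h) := by
  have hd0 : (d : ℚ) ≠ 0 := by exact_mod_cast hd.ne_zero
  intro hfin
  have step : ∀ n : ℕ, ∃ p : ℚ × ℚ, ∃ h' : (twistE d).Nonsingular p.1 p.2,
      2 ^ n • Point.some x y h = .some p.1 p.2 h' ∧ p.2 ≠ 0 := by
    intro n
    induction n with
    | zero => exact ⟨(x, y), h, by simp, hy⟩
    | succ n ih =>
      obtain ⟨p, h', e, hp⟩ := ih
      obtain ⟨x', y', h'', e', hy', -⟩ := twistE_exists_add_self hd hd1 h' hp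
      exact ⟨(x', y'), h'', by rw [pow_succ', mul_smul, two_nsmul, e, e'], hy'⟩
  choose p hp he hpy using step
  have hdbl : ∀ n, IsDouble ((p n).1 / d) ((p (n + 1)).1 / d) := by
    intro n
    obtain ⟨x', y', h'', e', hy', hD⟩ := twistE_exists_add_self hd hd1 (hp n) (hpy n)
    have := he (n + 1)
    rw [pow_succ', mul_smul, two_nsmul, he n, e', Point.some.injEq] at this
    rwa [this.1] at hD
  obtain ⟨m, hm, hpole⟩ := (hdbl 0).exists_hasTwoPole_of_isDouble (hdbl 1)
  have hpoles : ∀ k, HasTwoPole (m + 2 * k) ((p (2 + k)).1 / d) := by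
    intro k
    induction k with
    | zero => exact hpole
    | succ k ih => exact ih.isDouble (by omega) (hdbl (2 + k))
  have hinj : Function.Injective fun k : ℕ => 2 ^ (2 + k) • Point.some x y h := by
    intro k l hkl
    simp only [he, Point.some.injEq] at hkl
    have h1 := hpoles k
    have h2 := hpoles l
    rw [hkl.1] at h1
    have := h1.le_of_eq h2
    have := h2.le_of_eq h1
    omega
  exact Set.infinite_of_injective_forall_mem hinj (fun k => AddSubgroup.nsmul_mem_zmultiples _ _)
    hfin.finite_zmultiples

theorem rank_ne_zero_of_not_isOfFinAddOrder {A : Type*} [AddCommGroup A] {a : A}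
    (h : ¬ IsOfFinAddOrder a) : Module.rank ℤ A ≠ 0 := by
  rw [ne_eq, rank_eq_zero_iff]
  push Not
  exact ⟨a, fun n hn h0 => h (isOfFinAddOrder_iff_zsmul_eq_zero.mpr ⟨n, hn, h0⟩)⟩

theorem infinite_of_rank_ne_zero {A : Type*} [AddCommGroup A] (h : Module.rank ℤ A ≠ 0) :
    Infinite A := by
  by_contra hfin
  rw [not_infinite_iff_finite] at hfin
  refine h (rank_eq_zero_iff.mpr fun a => ?_)
  obtain ⟨n, hn, h0⟩ := isOfFinAddOrder_iff_zsmul_eq_zero.mp (isOfFinAddOrder_of_finite a)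
  exact ⟨n, hn, h0⟩

theorem fourSquareAPClasses_infinite_of_rank {K : Type*} [Field K] [CharZero K] {α : K}
    (hα : α ^ 2 = (d : K)) (hd0 : d ≠ 0) (h : Module.rank ℤ (twistE d).Point ≠ 0) :
    (fourSquareAPClasses K).Infinite := by
  have := infinite_of_rank_ne_zero h
  have hdK : (d : K) ≠ 0 := by exact_mod_cast hd0
  have hα0 : α ≠ 0 := by
    rintro rfl
    exact hdK (by rw [← hα]; simp)
  set S : Set (K × K) := {p | p.2 ^ 2 = p.1 * (p.1 + 3) * (p.1 - 1)} with hS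
  refine fourSquareAPClasses_infinite (S := S) ?_ fun p hp => hp
  intro hfin
  -- The isomorphism of E^d with E over K; `none` stands for the point at infinity.
  let g : (twistE d).Point → Option (K × K)
    | .zero => none
    | .some x y _ => some ((x : K) / d, y * α / d ^ 2)
  have hg : Function.Injective g := by
    rintro (_ | ⟨x, y, h⟩) (_ | ⟨x', y', h'⟩) hxy <;> simp only [g] at hxy
    · rfl
    · simp at hxy
    · simp at hxy
    · simp only [Option.some.injEq, Prod.mk.injEq] at hxy
      have e1 : (x : K) = x' := by
        have := hxy.1
        field_simp at this
        exact this
      have e2 : (y : K) = y' := by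
        have := hxy.2
        field_simp at this
        exact this
      simp only [Point.some.injEq]
      exact ⟨by exact_mod_cast e1, by exact_mod_cast e2⟩
  refine Set.infinite_of_injective_forall_mem hg (s := insert none (some '' S)) ?_
    ((hfin.image _).insert _)
  rintro (_ | ⟨x, y, h⟩)
  · exact .inl rfl
  · refine .inr ⟨_, ?_, rfl⟩
    have heq : (y : K) ^ 2 = x * (x + 3 * d) * (x - d) := by
      exact_mod_cast congrArg (Rat.cast : ℚ → K) ((twistE_equation x y).mp h.left)
    simp only [hS, Set.mem_ofPred_eq]
    rw [div_pow, mul_pow, hα, heq]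
    field_simp

end Twist

/-! ### Conjugation on a quadratic field and descent to ℚ -/

theorem IsNonconstFourSquareAP.false_of_rat_surjective {K : Type*} [Field K] [CharZero K]
    (hsurj : ∀ z : K, ∃ q : ℚ, z = q) {s : Fin 4 → K} (h : IsNonconstFourSquareAP s) : False := by
  obtain ⟨x, y, heq, hx⟩ := h.exists_point
  obtain ⟨x, rfl⟩ := hsurj x
  obtain ⟨y, rfl⟩ := hsurj y
  have := rat_points_trivial (x := x) (y := y) (by exact_mod_cast heq)
  exact hx (by exact_mod_cast this)

theorem exists_algHom_of_adjoin_eq_top {F K L : Type*} [Field F] [Field K] [Field L] [Algebra F K]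
    [Algebra F L] {α : K} (hint : IsIntegral F α) (hK : IntermediateField.adjoin F {α} = ⊤) {β : L}
    (hβ : Polynomial.aeval β (minpoly F α) = 0) : ∃ σ : K →ₐ[F] L, σ α = β := by
  let pb := IntermediateField.adjoin.powerBasis hint
  have hgen : pb.gen = IntermediateField.AdjoinSimple.gen F α :=
    IntermediateField.adjoin.powerBasis_gen hint
  let σ := pb.lift β (by rwa [hgen, IntermediateField.minpoly_gen])
  let ι := (IntermediateField.equivOfEq hK.symm).toAlgHom.comp
    (IntermediateField.topEquiv (F := F) (E := K)).symm.toAlgHom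
  refine ⟨σ.comp ι, ?_⟩
  have hι : ι α = pb.gen := by
    rw [hgen]
    rfl
  rw [AlgHom.comp_apply, hι]
  exact pb.lift_gen _ _

section Quadratic

variable {d : ℤ} {K : Type*} [Field K] [CharZero K] {α : K}

theorem isIntegral_of_sq_eq_intCast (hα : α ^ 2 = (d : K)) : IsIntegral ℚ α :=
  IsIntegral.of_pow two_pos (by
    rw [hα, show (d : K) = algebraMap ℚ K d by simp]
    exact isIntegral_algebraMap)

theorem exists_eq_add_mul (hα : α ^ 2 = (d : K)) (hK : IntermediateField.adjoin ℚ {α} = ⊤)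
    (z : K) : ∃ p q : ℚ, z = p + q * α := by
  have hz : z ∈ Algebra.adjoin ℚ {α} := by
    rw [← IntermediateField.adjoin_simple_toSubalgebra_of_isAlgebraic
      (isIntegral_of_sq_eq_intCast hα).isAlgebraic, hK]
    trivial
  induction hz using Algebra.adjoin_induction with
  | mem x hx => exact ⟨0, 1, by rw [Set.mem_singleton_iff.mp hx]; simp⟩
  | algebraMap r => exact ⟨r, 0, by simp⟩
  | add x y _ _ hx hy =>
    obtain ⟨p, q, rfl⟩ := hx
    obtain ⟨p', q', rfl⟩ := hy
    exact ⟨p + p', q + q', by push_cast; ring⟩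
  | mul x y _ _ hx hy =>
    obtain ⟨p, q, rfl⟩ := hx
    obtain ⟨p', q', rfl⟩ := hy
    exact ⟨p * p' + q * q' * d, p * q' + p' * q, by
      push_cast; linear_combination q * q' * hα⟩

theorem ne_ratCast (hd : Squarefree d) (hd1 : d ≠ 1) (hα : α ^ 2 = (d : K)) (q : ℚ) : α ≠ q := by
  rintro rfl
  refine hd1 (eq_one_of_squarefree_of_isSquare hd ⟨q, ?_⟩)
  have : q ^ 2 = (d : ℚ) := by exact_mod_cast hα
  rw [← this, sq]

/-- The nontrivial automorphism of a quadratic field. -/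
theorem exists_conj (hd : Squarefree d) (hd1 : d ≠ 1) (hα : α ^ 2 = (d : K))
    (hK : IntermediateField.adjoin ℚ {α} = ⊤) : ∃ σ : K →ₐ[ℚ] K, σ α = -α := by
  have hmin : minpoly ℚ α = Polynomial.X ^ 2 - Polynomial.C (d : ℚ) := by
    symm
    apply minpoly.eq_of_irreducible_of_monic
    · rw [Polynomial.irreducible_iff_roots_eq_zero_of_degree_le_three (by
        rw [Polynomial.natDegree_X_pow_sub_C]) (by rw [Polynomial.natDegree_X_pow_sub_C]; norm_num)]
      refine Multiset.eq_zero_of_forall_notMem fun q hq => ?_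
      have hq' := (Polynomial.mem_roots'.mp hq).2
      simp only [Polynomial.IsRoot.def, Polynomial.eval_sub, Polynomial.eval_pow,
        Polynomial.eval_X, Polynomial.eval_C] at hq'
      exact hd1 (eq_one_of_squarefree_of_isSquare hd ⟨q, by linarith⟩)
    · simp [hα]
    · exact Polynomial.monic_X_pow_sub_C _ two_ne_zero
  exact exists_algHom_of_adjoin_eq_top (isIntegral_of_sq_eq_intCast hα) hK
    (by rw [hmin]; simp [hα])

/-- If (p + qα)² is rational then pq = 0, so it equals p² or q²d. -/
theorem isSquare_or_of_isSquare (hd : Squarefree d) (hd1 : d ≠ 1) (hα : α ^ 2 = (d : K))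
    (hK : IntermediateField.adjoin ℚ {α} = ⊤) {a : ℚ} (h : IsSquare (a : K)) :
    IsSquare a ∨ IsSquare (d * a) := by
  obtain ⟨z, hz⟩ := h
  obtain ⟨p, q, rfl⟩ := exists_eq_add_mul hα hK z
  have h1 : ((2 * p * q : ℚ) : K) * α = ((a - p ^ 2 - q ^ 2 * d : ℚ) : K) := by
    push_cast
    linear_combination -hz - (q : K) ^ 2 * hα
  have h2 : p * q = 0 := by
    by_contra h0
    refine ne_ratCast hd hd1 hα ((a - p ^ 2 - q ^ 2 * d) / (2 * p * q)) ?_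
    have h3 : ((2 * p * q : ℚ) : K) ≠ 0 := by
      rw [mul_assoc]
      exact_mod_cast mul_ne_zero two_ne_zero h0
    rw [Rat.cast_div, eq_div_iff h3, ← h1, mul_comm]
  have h4 : a = p ^ 2 + q ^ 2 * d := by
    rw [mul_assoc, h2, mul_zero, Rat.cast_zero, zero_mul] at h1
    have : a - p ^ 2 - q ^ 2 * d = 0 := by exact_mod_cast h1.symm
    linarith
  rcases mul_eq_zero.mp h2 with rfl | rfl
  · exact .inr ⟨q * d, by rw [h4]; ring⟩
  · exact .inl ⟨p, by rw [h4]; ring⟩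

/-- In a quadratic field, two rational numbers that become squares are dependent modulo rational
squares. -/
theorem isSquare_or_isSquare_or_isSquare_mul (hd : Squarefree d) (hd1 : d ≠ 1)
    (hα : α ^ 2 = (d : K)) (hK : IntermediateField.adjoin ℚ {α} = ⊤) {a b : ℚ}
    (ha : IsSquare (a : K)) (hb : IsSquare (b : K)) :
    IsSquare a ∨ IsSquare b ∨ IsSquare (a * b) := by
  rcases isSquare_or_of_isSquare hd hd1 hα hK ha with h | h
  · exact .inl h
  rcases isSquare_or_of_isSquare hd hd1 hα hK hb with h' | h'
  · exact .inr (.inl h')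
  have hd0 : (d : ℚ) ≠ 0 := by exact_mod_cast hd.ne_zero
  refine .inr (.inr (isSquare_of_mul_self_mul hd0 ?_))
  rw [show (d : ℚ) * d * (a * b) = d * a * (d * b) by ring]
  exact h.mul h'

theorem eq_ratCast_of_conj_eq (hα : α ^ 2 = (d : K))
    (hK : IntermediateField.adjoin ℚ {α} = ⊤) {σ : K →ₐ[ℚ] K} (hσ : σ α = -α) {z : K}
    (hz : σ z = z) : ∃ p : ℚ, z = p := by
  obtain ⟨p, q, rfl⟩ := exists_eq_add_mul hα hK z
  refine ⟨p, ?_⟩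
  simp only [map_add, map_mul, map_ratCast, hσ] at hz
  linear_combination -hz / 2

theorem eq_ratCast_mul_of_conj_eq_neg (hα : α ^ 2 = (d : K))
    (hK : IntermediateField.adjoin ℚ {α} = ⊤) {σ : K →ₐ[ℚ] K} (hσ : σ α = -α) {z : K}
    (hz : σ z = -z) : ∃ q : ℚ, z = q * α := by
  obtain ⟨p, q, rfl⟩ := exists_eq_add_mul hα hK z
  refine ⟨q, ?_⟩
  simp only [map_add, map_mul, map_ratCast, hσ] at hz
  linear_combination hz / 2

theorem conj_conj (hα : α ^ 2 = (d : K)) (hK : IntermediateField.adjoin ℚ {α} = ⊤)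
    {σ : K →ₐ[ℚ] K} (hσ : σ α = -α) (z : K) : σ (σ z) = z := by
  obtain ⟨p, q, rfl⟩ := exists_eq_add_mul hα hK z
  simp [hσ]

/-- A point over a quadratic field with rational double has trivial abscissa. -/
theorem trivial_of_double_rational (hd : Squarefree d) (hd1 : d ≠ 1)
    (hα : α ^ 2 = (d : K)) (hK : IntermediateField.adjoin ℚ {α} = ⊤) {x y : K} {p q : ℚ}
    (hy : y ≠ 0) (hpq : q ^ 2 = p * (p + 3) * (p - 1))
    (e1 : (p : K) = ((x ^ 2 + 3 * 1 ^ 2) / (2 * y)) ^ 2)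
    (e2 : (p : K) + 3 * 1 = ((x ^ 2 + 6 * 1 * x - 3 * 1 ^ 2) / (2 * y)) ^ 2)
    (e3 : (p : K) - 1 = ((x ^ 2 - 2 * 1 * x - 3 * 1 ^ 2) / (2 * y)) ^ 2) : x = 3 ∨ x = -1 := by
  have key := @isSquare_or_isSquare_or_isSquare_mul d K _ _ α hd hd1 hα hK
  have s1 : IsSquare ((p : ℚ) : K) := e1 ▸ IsSquare.sq _
  have s2 : IsSquare ((p + 3 : ℚ) : K) := by
    push_cast
    rw [mul_one] at e2
    exact e2 ▸ IsSquare.sq _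
  have s3 : IsSquare ((p - 1 : ℚ) : K) := by
    push_cast
    exact e3 ▸ IsSquare.sq _
  have neg : ∀ a : ℚ, a < 0 → ¬ IsSquare a := fun a h => Rat.not_isSquare_of_neg h
  -- For p ≠ 1, two of p, p + 3, p - 1 are independent modulo rational squares, so they cannot both
  -- become squares in K. For p = 1 the third formula gives x² - 2x - 3 = 0.
  rcases rat_points_trivial hpq with (rfl | rfl | rfl) | rfl | rfl
  · exfalso
    rcases key s2 s3 with h | h | h
    · norm_num at h
    · exact neg _ (by norm_num) h
    · exact neg _ (by norm_num) h
  · exfalso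
    rcases key s1 s3 with h | h | h
    · exact neg _ (by norm_num) h
    · exact neg _ (by norm_num) h
    · norm_num at h
  · have : x ^ 2 - 2 * 1 * x - 3 * 1 ^ 2 = 0 := by
      rw [Rat.cast_one, sub_self, eq_comm, sq_eq_zero_iff, div_eq_zero_iff] at e3
      exact e3.resolve_right (mul_ne_zero two_ne_zero hy)
    have : (x - 3) * (x + 1) = 0 := by linear_combination this
    rcases mul_eq_zero.mp this with h | h
    · exact .inl (sub_eq_zero.mp h)
    · exact .inr (eq_neg_of_add_eq_zero_left h)
  · exfalso
    rcases key s1 s3 with h | h | h <;> norm_num at h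
  · exfalso
    rcases key s1 s2 with h | h | h
    · exact neg _ (by norm_num) h
    · norm_num at h
    · exact neg _ (by norm_num) h

theorem twist_equation_of_conj_eq {p q : ℚ} (hα : α ^ 2 = (d : K)) (hd0 : d ≠ 0)
    (h : ((q : K) * α) ^ 2 = p * (p + 3) * (p - 1)) : (twistE d).Equation (d * p) (d ^ 2 * q) := by
  rw [twistE_equation_iff d hd0]
  have : (d : K) * q ^ 2 = p * (p + 3) * (p - 1) := by linear_combination h - (q : K) ^ 2 * hα
  exact_mod_cast this

open scoped Classical in
/-- A nontrivial point over a quadratic field gives a nontrivial point on the twist. -/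
theorem exists_twist_point (hd : Squarefree d) (hd1 : d ≠ 1) (hα : α ^ 2 = (d : K))
    (hK : IntermediateField.adjoin ℚ {α} = ⊤) {x y : K} (h : y ^ 2 = x * (x + 3) * (x - 1))
    (hx : ¬((x = 0 ∨ x = -3 ∨ x = 1) ∨ x = 3 ∨ x = -1)) :
    ∃ p q : ℚ, q ≠ 0 ∧ (twistE d).Equation (d * p) (d ^ 2 * q) := by
  obtain ⟨σ, hσ⟩ := exists_conj hd hd1 hα hK
  push Not at hx
  obtain ⟨⟨hx1, hx2, hx3⟩, hx4, hx5⟩ := hx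
  have hf : x * (x + 3) * (x - 1) ≠ 0 :=
    mul_ne_zero (mul_ne_zero hx1 fun h0 => hx2 (eq_neg_of_add_eq_zero_left h0))
      (sub_ne_zero.mpr hx3)
  have hy : y ≠ 0 := by
    rintro rfl
    exact hf (by rw [← h]; ring)
  let E : WeierstrassCurve.Affine K := (twistE 1)⁄K
  have c1 : E.a₁ = 0 := by simp [E, twistE]
  have c2 : E.a₂ = 2 * 1 := by simp [E, twistE]
  have c3 : E.a₃ = 0 := by simp [E, twistE]
  have c4 : E.a₄ = -3 * 1 ^ 2 := by simp [E, twistE]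
  have c6 : E.a₆ = 0 := by simp [E, twistE]
  have heq : ∀ u v : K, E.Equation u v ↔ v ^ 2 = u * (u + 3) * (u - 1) := by
    intro u v
    rw [equation_iff_of_coeffs c1 c2 c3 c4 c6, mul_one]
  have hell : WeierstrassCurve.IsElliptic E := by
    have := twistE_isElliptic 1 one_ne_zero
    exact inferInstanceAs (WeierstrassCurve.IsElliptic ((twistE 1).map (algebraMap ℚ K)))
  have hns : E.Nonsingular x y := (equation_iff_nonsingular).mp ((heq x y).mpr h)
  let P : E.Point := .some x y hns
  let S : E.Point →+ E.Point := Point.map (W' := twistE 1) σ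
  have hSS : ∀ Q : E.Point, S (S Q) = Q := by
    rintro (_ | ⟨u, v, huv⟩)
    · exact (congrArg S S.map_zero).trans S.map_zero
    · change Point.map (W' := twistE 1) σ (Point.map (W' := twistE 1) σ _) = _
      rw [Point.map_some, Point.map_some, Point.some.injEq]
      exact ⟨conj_conj hα hK hσ u, conj_conj hα hK hσ v⟩
  -- If 2(P - σP) = 0, then 2P is fixed by σ and has rational coordinates.
  by_cases hR : (P - S P) + (P - S P) = 0
  · exfalso
    have h2 : P + P = S (P + P) := by
      rw [map_add, ← sub_eq_zero, ← hR]
      abel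
    obtain ⟨x', y', h', hadd, e1, e2, e3⟩ := exists_add_self_eq_some c1 c2 c3 c4 c6 hns hy
    change P + P = _ at hadd
    rw [hadd] at h2
    change _ = Point.map (W' := twistE 1) σ _ at h2
    rw [Point.map_some, Point.some.injEq] at h2
    obtain ⟨p, rfl⟩ := eq_ratCast_of_conj_eq hα hK hσ h2.1.symm
    obtain ⟨q, rfl⟩ := eq_ratCast_of_conj_eq hα hK hσ h2.2.symm
    have hpq := (heq _ _).mp h'.left
    rcases trivial_of_double_rational hd hd1 hα hK hy (q := q) (by exact_mod_cast hpq) e1 e2 e3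
      with h0 | h0
    · exact hx4 h0
    · exact hx5 h0
  -- Anti-invariance fixes the abscissa and negates the ordinate, so the point is (p, qα) with p, q
  -- rational.
  · have hSR : S (P - S P) = -(P - S P) := by
      rw [map_sub, hSS, neg_sub]
    generalize P - S P = R at hR hSR
    rcases R with _ | ⟨u, v, huv⟩
    · exact absurd (add_zero _) hR
    · have hv : v ≠ 0 := by
        rintro rfl
        refine hR (Point.add_self_of_Y_eq ?_)
        simp [negY, c1, c3]
      change Point.map (W' := twistE 1) σ _ = _ at hSR
      rw [Point.map_some, Point.neg_some, Point.some.injEq] at hSR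
      obtain ⟨p, rfl⟩ := eq_ratCast_of_conj_eq hα hK hσ hSR.1
      obtain ⟨q, rfl⟩ := eq_ratCast_mul_of_conj_eq_neg hα hK hσ (hSR.2.trans (by
        simp [negY, c1, c3]))
      refine ⟨p, q, ?_, twist_equation_of_conj_eq hα hd.ne_zero ((heq _ _).mp huv.left)⟩
      rintro rfl
      simp at hv

end Quadratic

/-! ### The equivalence and the infinitude of classes -/

theorem mainTheorem3 (d : ℤ) (hd : Squarefree d)
    (K : Type*) [Field K] [CharZero K] (α : K) (hα : α ^ 2 = (d : K))
    (hK : IntermediateField.adjoin ℚ {α} = ⊤) :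
    ((∃ s : Fin 4 → K, IsNonconstFourSquareAP s) ↔ Module.rank ℤ (twistE d).Point ≠ 0) ∧
      (Module.rank ℤ (twistE d).Point ≠ 0 → (fourSquareAPClasses K).Infinite) := by
  have hinf : Module.rank ℤ (twistE d).Point ≠ 0 → (fourSquareAPClasses K).Infinite :=
    fourSquareAPClasses_infinite_of_rank hα hd.ne_zero
  refine ⟨⟨?_, fun h => ?_⟩, hinf⟩
  · rintro ⟨s, hs⟩
    by_cases hd1 : d = 1
    · exfalso
      subst hd1
      refine hs.false_of_rat_surjective fun z => ?_
      obtain ⟨p, q, rfl⟩ := exists_eq_add_mul hα hK z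
      rw [Int.cast_one, sq_eq_one_iff] at hα
      rcases hα with rfl | rfl
      · exact ⟨p + q, by push_cast; ring⟩
      · exact ⟨p - q, by push_cast; ring⟩
    · obtain ⟨x, y, heq, hx⟩ := hs.exists_point
      obtain ⟨p, q, hq, h⟩ := exists_twist_point hd hd1 hα hK heq hx
      have := twistE_isElliptic d hd.ne_zero
      have hd0 : (d : ℚ) ≠ 0 := by exact_mod_cast hd.ne_zero
      exact rank_ne_zero_of_not_isOfFinAddOrder (twistE_not_isOfFinAddOrder hd hd1
        (equation_iff_nonsingular.mp h) (mul_ne_zero (pow_ne_zero 2 hd0) hq))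
  · obtain ⟨_, s, _, hs, _⟩ := (hinf h).nonempty
    exact ⟨s, hs⟩
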